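/- Let $M=\mathbb R^3$ with coordinates $(x,y,z)$ be the Heisenberg group, with the left-invariant fields $X_1=\partial_x-\frac y2\partial_z$, $X_2=\partial_y+\frac x2\partial_z$, and let $q_0=(0,0,0)$ be its identity. Consider the sub-Lorentzian structure with orthonormal frame $(X_1,X_2)$ ($X_1$ timelike) and time orientation $X_1$. Let $I^+(q_0)$ be the chronological future of $q_0$: the set of end points $q(T)$, $T>0$, of Lipschitz curves $q:[0,T]\to M$ with $q(0)=q_0$ and, for a.e. $t$, $\dot q=u_1X_1+u_2X_2$ with $u_1>|u_2|$. For $q_1\in I^+(q_0)$ the reduced (time-maximal) problem is $$\dot q=u_1X_1+u_2X_2,\qquad u_1^2-u_2^2=1,\ u_1>0,\qquad q(0)=q_0,\ q(t_1)=q_1,\qquad t_1\to\max,$$ over $t_1>0$ and absolutely continuous curves $q:[0,t_1]\to M$ satisfying the system almost everywhere, that is, over arclength parametrized future directed timelike curves from $q_0$ to $q_1$. Let $h_i(\lambda)=\langle\lambda,X_i\rangle$ on $T^*M$, $H=\frac12(h_2^2-h_1^2)$, let $\vec H$ be the Hamiltonian vector field of $H$ and $\pi:T^*M\to M$ the projection.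 Put $C=\{\lambda\in T^*_{q_0}M : h_1(\lambda)^2-h_2(\lambda)^2=1,\ h_1(\lambda)<0\}$, $N=C\times(0,+\infty)$ and $\mathrm{Exp}(\lambda,t)=\pi(e^{t\vec H}(\lambda))$. A trajectory $q:[0,T]\to M$ is extremal with multiplier $\nu\in\{0,-1\}$ if it lifts to a Lipschitz curve $\lambda_t\in T^*_{q(t)}M$, with controls $u(t)\in U=\{u_1\ge|u_2|\}$, such that for a.e. $t$, for $h^\nu_u=u_1h_1+u_2h_2-\nu\sqrt{u_1^2-u_2^2}$, one has $\dot\lambda_t=\vec h^\nu_{u(t)}(\lambda_t)$, $h^\nu_{u(t)}(\lambda_t)=\max_{v\in U}h^\nu_v(\lambda_t)=0$ and $(\nu,\lambda_t)\ne(0,0)$. It is strictly normal if it is extremal with $\nu=-1$ but not with $\nu=0$. **Theorem.** The map $\mathrm{Exp}:N\to I^+(q_0)$ is a bijection. For every $q_1\in I^+(q_0)$, with $(\lambda,t_1)=\mathrm{Exp}^{-1}(q_1)\in N$, the curve $q(t)=\mathrm{Exp}(\lambda,t)$, $t\in[0,t_1]$, is a strictly normal Lipschitz trajectory, and it is the unique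 optimal trajectory of the reduced problem from $q_0$ to $q_1$: every admissible trajectory from $q_0$ to $q_1$ on an interval $[0,T]$ has $T\le t_1$, and one with $T=t_1$ coincides with $q$ on $[0,t_1]$. -/

import Mathlib

open Set MeasureTheory
open scoped NNReal

noncomputable section

namespace HeisSL

/-- The underlying manifold `ℝ³` of the Heisenberg group; `q 0, q 1, q 2` are `x, y, z`. -/
abbrev M : Type := Fin 3 → ℝ

/-- The frame field `X₁ = ∂_x - (y/2) ∂_z`. -/
def X₁ (q : M) : M := ![1, 0, -(q 1) / 2]

/-- The frame field `X₂ = ∂_y + (x/2) ∂_z`. -/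
def X₂ (q : M) : M := ![0, 1, q 0 / 2]

/-- The base point, the identity of the group. -/
def q₀ : M := 0

/-- The full control set `U = {u₁ ≥ |u₂|}`: a horizontal vector `u₁ X₁ + u₂ X₂` is future directed
nonspacelike for the Lorentzian metric with orthonormal frame `(X₁, X₂)` and time orientation `X₁`
if and only if it is nonzero and `(u₁, u₂) ∈ U`. -/
def U : Set (ℝ × ℝ) := {u | |u.2| ≤ u.1}

/-- The timelike controls, the interior `{u₁ > |u₂|}` of `U`. -/
def timelikeControls : Set (ℝ × ℝ) := {u | |u.2| < u.1}

/-- The controls of the arclength parametrized timelike problem: `u₁² - u₂² = 1`, `u₁ > 0`. -/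
def unitControls : Set (ℝ × ℝ) := {u | u.1 ^ 2 - u.2 ^ 2 = 1 ∧ 0 < u.1}

/-- `q̇(t) = u₁ X₁(q(t)) + u₂ X₂(q(t))` with a control `u(t) ∈ V`, for almost every `t ∈ [0, T]`. -/
def SolvesControlSystem (V : Set (ℝ × ℝ)) (T : ℝ) (q : ℝ → M) : Prop :=
  ∀ᵐ t ∂(volume.restrict (Icc 0 T)),
    ∃ u ∈ V, HasDerivAt q (u.1 • X₁ (q t) + u.2 • X₂ (q t)) t

/-- `I⁺(a)`: the points reached from `a` by a Lipschitz future directed timelike curve. -/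
def chronologicalFuture (a : M) : Set M :=
  {b | ∃ (T : ℝ) (q : ℝ → M), 0 < T ∧ (∃ K : ℝ≥0, LipschitzOnWith K q (Icc 0 T)) ∧
    SolvesControlSystem timelikeControls T q ∧ q 0 = a ∧ q T = b}

/-- Admissible trajectories on `[0, T]`, from `q₀` to `q₁`, of the time-maximal problem:
arclength parametrized future directed timelike curves. An arclength parametrization of a Lipschitz
timelike curve is in general only absolutely continuous, so this is what is asked. -/
structure IsAdmissible (q₁ : M) (T : ℝ) (q : ℝ → M) : Prop where
  pos : 0 < T
  ac : AbsolutelyContinuousOnInterval q 0 T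
  ode : SolvesControlSystem unitControls T q
  init : q 0 = q₀
  final : q T = q₁

/-- Optimality in the problem `T → max` over all admissible trajectories from `q₀` to `q₁`. -/
def IsOptimal (q₁ : M) (T : ℝ) (q : ℝ → M) : Prop :=
  IsAdmissible q₁ T q ∧ ∀ (T' : ℝ) (q' : ℝ → M), IsAdmissible q₁ T' q' → T' ≤ T

/-- `q` on `[0, T]` is optimal, and every optimal trajectory is `q` on `[0, T]`. -/
def IsUniqueOptimal (q₁ : M) (T : ℝ) (q : ℝ → M) : Prop :=
  IsOptimal q₁ T q ∧
    ∀ (T' : ℝ) (q' : ℝ → M), IsOptimal q₁ T' q' → T' = T ∧ EqOn q' q (Icc 0 T)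

/-- The cotangent bundle `T*M = ℝ³ × ℝ³` in canonical coordinates `(q, p)`. -/
abbrev CotM : Type := M × M

/-- The Hamiltonian linear on fibers, `h₁(q, p) = ⟨p, X₁(q)⟩`. -/
def h₁ (l : CotM) : ℝ := l.2 ⬝ᵥ X₁ l.1

/-- The Hamiltonian linear on fibers, `h₂(q, p) = ⟨p, X₂(q)⟩`. -/
def h₂ (l : CotM) : ℝ := l.2 ⬝ᵥ X₂ l.1

/-- The Hamiltonian vector field: `q̇ = ∂h/∂p`, `ṗ = -∂h/∂q`. -/
def hamVF (h : CotM → ℝ) (l : CotM) : CotM :=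
  (fun i => fderiv ℝ h l (0, Pi.single i 1), fun i => -fderiv ℝ h l (Pi.single i 1, 0))

open Classical in
/-- The flow `e^{tV}` of a complete vector field with unique integral curves (the value is
`l` itself where no global integral curve through `l` exists). -/
def flow (V : CotM → CotM) (t : ℝ) (l : CotM) : CotM :=
  if h : ∃ γ : ℝ → CotM, γ 0 = l ∧ ∀ s, HasDerivAt γ (V (γ s)) s then h.choose t else l

/-- `H = (h₂² - h₁²) / 2`. -/
def H (l : CotM) : ℝ := (h₂ l ^ 2 - h₁ l ^ 2) / 2

/-- The covectors at `q₀` with `h₁ = -cosh ψ`, `h₂ = sinh ψ` for some `ψ`: the branch `h₁ < 0` of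
the hyperbolic cylinder `h₁² - h₂² = 1`, that is `H = -1/2`. -/
def C : Set CotM := {l | l.1 = q₀ ∧ H l = -1 / 2 ∧ h₁ l < 0}

/-- `N = C × (0, ∞)`. -/
def N : Set (CotM × ℝ) := {n | n.1 ∈ C ∧ 0 < n.2}

/-- The exponential mapping `(l, t) ↦ π (e^{tH⃗} l)`. -/
def Exp (n : CotM × ℝ) : M := (flow (hamVF H) n.2 n.1).1

/-- The Hamiltonian `u₁ h₁ + u₂ h₂ - ν √(u₁² - u₂²)` of the Pontryagin maximum principle. -/
def pmpHam (ν : ℝ) (u : ℝ × ℝ) (l : CotM) : ℝ :=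
  u.1 * h₁ l + u.2 * h₂ l - ν * √(u.1 ^ 2 - u.2 ^ 2)

/-- `q` on `[0, T]` is the projection of an extremal with multiplier `ν`: the conditions of the
Pontryagin maximum principle for the length maximization problem with control set `U`. -/
def IsExtremalTrajectory (ν : ℝ) (T : ℝ) (q : ℝ → M) : Prop :=
  ∃ (l : ℝ → CotM) (u : ℝ → ℝ × ℝ),
    (∃ K : ℝ≥0, LipschitzOnWith K l (Icc 0 T)) ∧
    (∀ t ∈ Icc 0 T, (l t).1 = q t) ∧
    ∀ᵐ t ∂(volume.restrict (Icc 0 T)),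
      u t ∈ U ∧
      HasDerivAt l (hamVF (pmpHam ν (u t)) (l t)) t ∧
      (∀ v ∈ U, pmpHam ν v (l t) ≤ pmpHam ν (u t) (l t)) ∧
      pmpHam ν (u t) (l t) = 0 ∧
      (ν, (l t).2) ≠ (0, 0)

/-- Normal (`ν = -1`) but not abnormal (`ν = 0`). -/
def IsStrictlyNormal (T : ℝ) (q : ℝ → M) : Prop :=
  IsExtremalTrajectory (-1) T q ∧ ¬ IsExtremalTrajectory 0 T q

end HeisSL

end

/-!
In the null coordinates `a = x + y`, `b = x - y` a horizontal curve with control `(u₁, u₂)`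
satisfies `a' = u₁ + u₂`, `b' = u₁ - u₂` and `4 z' = b a' - a b'`, so that `a`, `b` increase along timelike
curves and `(a b - 4 z)' = 2 a b'`. In these coordinates the proper time is the integral of
`√(a' b')`, and taking `a` as the parameter turns the time-maximal problem into the maximization of
the strictly concave functional `∫ √(db/da) da` under constraints that are linear in `b`. This
convexity is used through an explicit calibration.

Integrating the Hamiltonian system of `H` from `C` gives the geodesics `geod u c`, along which
`a' = u e^{ct} = u + c a` and `b' = 1 / a'`. Let `G` be a primitive of `1 / (u + c a)`. Along a curve
with `a' b' = 1` the function `(G a + u b + c (a b - 4 z) / 2) / 2` has the derivative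
`(a' / (u + c a) + b' (u + c a)) / 2`, which is at least `1`, with equality if and only if
`a' = u + c a` (`time_le_calibration`). Since the function depends on the point only, every
admissible curve takes at most the time of the geodesic with the same end point, and in case of
equality it solves the equation `a' = u + c a`, which leaves only the geodesic
(`eqOn_geod_of_slope`). Absolute continuity enters through the fundamental theorem of calculus.

Injectivity of `Exp` is a consequence of this optimality: two geodesics with the same end point
coincide (`geod_injective`). For surjectivity, timelike curves end in the set
`a > 0`, `b > 0`, `4 |z| < a b` (`null_pos`, `abs_vertical_lt`), and the end point of a geodesic has
`4 z / (a b) = (sinh p - p) / (cosh p - 1)` with `p = c t`, which takes every nonzero value in `(-1, 1)`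
by the intermediate value theorem (`exists_sinh_sub_eq`), while `c = 0` gives `z = 0`; time and
initial rapidity then fit `a` and `b`.

The Hamiltonian lift of a geodesic satisfies the maximum principle with `ν = -1` by the reversed
Cauchy-Schwarz inequality. An abnormal lift would have `h₁ = h₂ = 0`, because the control lies in the
interior of the cone `U`; differentiating `h₂ = 0` shows that its vertical momentum vanishes too, so
the covector is zero, which is excluded.
-/

namespace HeisSL

/-! ### Absolutely continuous functions and uniqueness for autonomous equations -/

lemma _root_.AbsolutelyContinuousOnInterval.lipschitzOnWith_comp {X Y : Type*}
    [PseudoMetricSpace X] [PseudoMetricSpace Y] {g : X → Y} {f : ℝ → X} {K : ℝ≥0} {s : Set X}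
    {a b : ℝ} (hg : LipschitzOnWith K g s) (hf : AbsolutelyContinuousOnInterval f a b)
    (hs : MapsTo f (uIcc a b) s) : AbsolutelyContinuousOnInterval (g ∘ f) a b := by
  rw [absolutelyContinuousOnInterval_iff] at hf ⊢
  intro ε hε
  obtain ⟨δ, hδ, h⟩ := hf (ε / (K + 1)) (by positivity)
  refine ⟨δ, hδ, fun E hE hEδ => ?_⟩
  have hlip : ∑ i ∈ Finset.range E.1, dist ((g ∘ f) (E.2 i).1) ((g ∘ f) (E.2 i).2) ≤
      K * ∑ i ∈ Finset.range E.1, dist (f (E.2 i).1) (f (E.2 i).2) := by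
    rw [Finset.mul_sum]
    exact Finset.sum_le_sum fun i hi =>
      hg.dist_le_mul _ (hs (hE.1 i hi).1) _ (hs (hE.1 i hi).2)
  have h0 : 0 ≤ ∑ i ∈ Finset.range E.1, dist (f (E.2 i).1) (f (E.2 i).2) :=
    Finset.sum_nonneg fun _ _ => dist_nonneg
  have h1 := (lt_div_iff₀ (by positivity)).1 (h E hE hEδ)
  nlinarith

lemma _root_.AbsolutelyContinuousOnInterval.le_of_ae_hasDerivAt_nonneg {f : ℝ → ℝ} {a b : ℝ}
    (hf : AbsolutelyContinuousOnInterval f a b) (hab : a ≤ b)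
    (hd : ∀ᵐ t ∂(volume.restrict (Icc a b)), ∃ d, 0 ≤ d ∧ HasDerivAt f d t) : f a ≤ f b := by
  have h := hf.integral_deriv_eq_sub
  have h0 : 0 ≤ ∫ t in a..b, deriv f t := by
    refine intervalIntegral.integral_nonneg_of_ae_restrict hab ?_
    filter_upwards [hd] with t ⟨d, hd0, hd⟩
    simpa [hd.deriv] using hd0
  linarith

lemma _root_.AbsolutelyContinuousOnInterval.monotoneOn_of_ae_hasDerivAt_nonneg {f : ℝ → ℝ}
    {a b : ℝ} (hf : AbsolutelyContinuousOnInterval f a b)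
    (hd : ∀ᵐ t ∂(volume.restrict (Icc a b)), ∃ d, 0 ≤ d ∧ HasDerivAt f d t) :
    MonotoneOn f (Icc a b) := by
  intro s hs t ht hst
  have hsub : Icc s t ⊆ Icc a b := Icc_subset_Icc hs.1 ht.2
  have hab : a ≤ b := hs.1.trans hs.2
  refine (hf.mono ?_).le_of_ae_hasDerivAt_nonneg hst (ae_restrict_of_ae_restrict_of_subset hsub hd)
  rwa [uIcc_of_le hst, uIcc_of_le hab]

lemma _root_.MonotoneOn.ae_hasDerivAt_eq_zero {f : ℝ → ℝ} {a b : ℝ}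
    (hf : MonotoneOn f (Icc a b)) (h : f b ≤ f a) :
    ∀ᵐ t ∂(volume.restrict (Icc a b)), ∀ d, HasDerivAt f d t → d = 0 := by
  rw [← Measure.restrict_congr_set (Ioo_ae_eq_Icc (a := a) (b := b))]
  refine (ae_restrict_iff' measurableSet_Ioo).2 (.of_forall fun t ht d hd => ?_)
  have hab : a ≤ b := (ht.1.trans ht.2).le
  refine hd.unique ((hasDerivAt_const t (f a)).congr_of_eventuallyEq ?_)
  filter_upwards [Ioo_mem_nhds ht.1 ht.2] with s hs
  exact le_antisymm ((hf ⟨hs.1.le, hs.2.le⟩ (right_mem_Icc.2 hab) hs.2.le).trans h)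
    (hf (left_mem_Icc.2 hab) ⟨hs.1.le, hs.2.le⟩ hs.1.le)

lemma ae_restrict_Icc_neBot {T : ℝ} (hT : 0 < T) :
    (ae (volume.restrict (Icc (0 : ℝ) T))).NeBot := by
  rw [ae_neBot, Ne, Measure.restrict_eq_zero]
  simp [hT]

lemma _root_.AbsolutelyContinuousOnInterval.lt_of_ae_hasDerivAt_pos {f : ℝ → ℝ} {T : ℝ}
    (hf : AbsolutelyContinuousOnInterval f 0 T) (hT : 0 < T)
    (hd : ∀ᵐ t ∂(volume.restrict (Icc 0 T)), ∃ d, 0 < d ∧ HasDerivAt f d t) : f 0 < f T := by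
  have hmono := hf.monotoneOn_of_ae_hasDerivAt_nonneg
    (hd.mono fun t ⟨d, hd0, hd⟩ => ⟨d, hd0.le, hd⟩)
  by_contra! hle
  have := ae_restrict_Icc_neBot hT
  obtain ⟨t, ⟨d, hd0, hd⟩, h⟩ := (hd.and (hmono.ae_hasDerivAt_eq_zero hle)).exists
  exact hd0.ne' (h d hd)

lemma _root_.AbsolutelyContinuousOnInterval.eqOn_of_ae_hasDerivAt {f g : ℝ → ℝ} {T : ℝ}
    (hf : AbsolutelyContinuousOnInterval f 0 T) (hg : AbsolutelyContinuousOnInterval g 0 T)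
    (hT : 0 ≤ T) (h0 : f 0 = g 0)
    (hd : ∀ᵐ t ∂(volume.restrict (Icc 0 T)), ∃ d, HasDerivAt f d t ∧ HasDerivAt g d t) :
    EqOn f g (Icc 0 T) := by
  rw [ae_restrict_iff' measurableSet_Icc, ← uIcc_of_le hT] at hd
  obtain ⟨k, hk⟩ := (hf.sub hg).const_of_ae_hasDerivAt_zero (by
    filter_upwards [hd] with t h ht
    obtain ⟨d, h1, h2⟩ := h ht
    simpa using h1.sub h2)
  intro t ht
  have h1 := hk t (by rwa [uIcc_of_le hT])
  have h2 := hk 0 left_mem_uIcc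
  simp only [Pi.sub_apply, h0, sub_self] at h1 h2
  linarith

lemma _root_.ContDiff.absolutelyContinuousOnInterval {f : ℝ → ℝ} (hf : ContDiff ℝ 1 f)
    (a b : ℝ) : AbsolutelyContinuousOnInterval f a b :=
  hf.contDiffOn.absolutelyContinuousOnInterval

lemma contDiff_one_of_hasDerivAt {E : Type*} [NormedAddCommGroup E] [NormedSpace ℝ E]
    {f f' : ℝ → E} (hf : ∀ t, HasDerivAt f (f' t) t) (hf' : Continuous f') : ContDiff ℝ 1 f := by
  rw [contDiff_one_iff_deriv]
  exact ⟨fun t => (hf t).differentiableAt, by rwa [funext fun t => (hf t).deriv]⟩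

lemma _root_.ContDiff.exists_lipschitzOnWith_Icc {E : Type*} [NormedAddCommGroup E]
    [NormedSpace ℝ E] {f : ℝ → E} (hf : ContDiff ℝ 1 f) (a b : ℝ) :
    ∃ K : ℝ≥0, LipschitzOnWith K f (Icc a b) :=
  hf.contDiffOn.exists_lipschitzOnWith (by decide) (convex_Icc _ _) isCompact_Icc

/-- A `C¹` vector field on a finite-dimensional space has at most one global integral curve
with a given initial value. -/
lemma eq_of_hasDerivAt_of_contDiff {E : Type*} [NormedAddCommGroup E] [NormedSpace ℝ E]
    [ProperSpace E] {V : E → E} (hV : ContDiff ℝ 1 V) {γ δ : ℝ → E}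
    (hγ : ∀ t, HasDerivAt γ (V (γ t)) t) (hδ : ∀ t, HasDerivAt δ (V (δ t)) t)
    (h0 : γ 0 = δ 0) : γ = δ := by
  have hcγ : Continuous γ := continuous_iff_continuousAt.2 fun t => (hγ t).continuousAt
  have hcδ : Continuous δ := continuous_iff_continuousAt.2 fun t => (hδ t).continuousAt
  funext t
  set R := |t| + 1
  have hR : 0 < R := by positivity
  have htR : t ∈ Ioo (-R) R := abs_lt.1 (lt_add_one |t|)
  -- on a bounded time interval both curves stay in one ball, where `V` is Lipschitz
  obtain ⟨r, hr⟩ := ((isCompact_Icc (a := -R) (b := R)).image hcγ |>.union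
    (isCompact_Icc.image hcδ)).isBounded.subset_closedBall (0 : E)
  obtain ⟨K, hK⟩ := hV.contDiffOn.exists_lipschitzOnWith (by decide)
    (convex_closedBall (0 : E) r) (isCompact_closedBall (0 : E) r)
  exact ODE_solution_unique_of_mem_Ioo (v := fun _ => V) (s := fun _ => Metric.closedBall 0 r)
    (t₀ := 0) (fun _ _ => hK) ⟨by linarith, hR⟩
    (fun s hs => ⟨hγ s, hr (Or.inl (mem_image_of_mem _ (Ioo_subset_Icc_self hs)))⟩)
    (fun s hs => ⟨hδ s, hr (Or.inr (mem_image_of_mem _ (Ioo_subset_Icc_self hs)))⟩) h0 htR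

/-! ### The Hamiltonian vector fields -/

lemma h₁_eq (l : CotM) : h₁ l = l.2 0 - l.1 1 * l.2 2 / 2 := by
  simp [h₁, X₁, dotProduct, Fin.sum_univ_three]; ring

lemma h₂_eq (l : CotM) : h₂ l = l.2 1 + l.1 0 * l.2 2 / 2 := by
  simp [h₂, X₂, dotProduct, Fin.sum_univ_three]; ring

lemma hasFDerivAt_base (l : CotM) (i : Fin 3) :
    HasFDerivAt (fun l : CotM => l.1 i)
      ((ContinuousLinearMap.proj (R := ℝ) (φ := fun _ : Fin 3 => ℝ) i).comp
        (ContinuousLinearMap.fst ℝ M M)) l :=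
  ((ContinuousLinearMap.proj (R := ℝ) (φ := fun _ : Fin 3 => ℝ) i).comp
    (ContinuousLinearMap.fst ℝ M M)).hasFDerivAt

lemma hasFDerivAt_fibre (l : CotM) (i : Fin 3) :
    HasFDerivAt (fun l : CotM => l.2 i)
      ((ContinuousLinearMap.proj (R := ℝ) (φ := fun _ : Fin 3 => ℝ) i).comp
        (ContinuousLinearMap.snd ℝ M M)) l :=
  ((ContinuousLinearMap.proj (R := ℝ) (φ := fun _ : Fin 3 => ℝ) i).comp
    (ContinuousLinearMap.snd ℝ M M)).hasFDerivAt

lemma exists_hasFDerivAt_h₁ (l : CotM) : ∃ D : CotM →L[ℝ] ℝ, HasFDerivAt h₁ D l ∧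
    ∀ v, D v = v.2 0 - (l.1 1 * v.2 2 + v.1 1 * l.2 2) / 2 := by
  rw [show h₁ = fun l : CotM => l.2 0 - l.1 1 * l.2 2 * (1 / 2) by
    funext l; rw [h₁_eq]; ring]
  refine ⟨_, (hasFDerivAt_fibre l 0).sub
    (((hasFDerivAt_base l 1).mul (hasFDerivAt_fibre l 2)).mul_const (1 / 2)), fun v => ?_⟩
  simp
  ring

lemma exists_hasFDerivAt_h₂ (l : CotM) : ∃ D : CotM →L[ℝ] ℝ, HasFDerivAt h₂ D l ∧
    ∀ v, D v = v.2 1 + (l.1 0 * v.2 2 + v.1 0 * l.2 2) / 2 := by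
  rw [show h₂ = fun l : CotM => l.2 1 + l.1 0 * l.2 2 * (1 / 2) by
    funext l; rw [h₂_eq]; ring]
  refine ⟨_, (hasFDerivAt_fibre l 1).add
    (((hasFDerivAt_base l 0).mul (hasFDerivAt_fibre l 2)).mul_const (1 / 2)), fun v => ?_⟩
  simp
  ring

/-- The Hamiltonian system of the maximum principle; the cost term does not depend on the
covector, so `ν` drops out. -/
lemma hamVF_pmpHam (ν : ℝ) (u : ℝ × ℝ) (l : CotM) :
    hamVF (pmpHam ν u) l =
      (u.1 • X₁ l.1 + u.2 • X₂ l.1, ![-(u.2 * l.2 2) / 2, u.1 * l.2 2 / 2, 0]) := by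
  obtain ⟨D₁, hD₁, e₁⟩ := exists_hasFDerivAt_h₁ l
  obtain ⟨D₂, hD₂, e₂⟩ := exists_hasFDerivAt_h₂ l
  have hD : HasFDerivAt (pmpHam ν u) (u.1 • D₁ + u.2 • D₂) l :=
    ((hD₁.const_mul u.1).add (hD₂.const_mul u.2)).sub_const _
  rw [hamVF, hD.fderiv]
  ext i <;> fin_cases i <;> simp [e₁, e₂, X₁, X₂] <;> ring

lemma hamVF_H (l : CotM) :
    hamVF H l = (-h₁ l • X₁ l.1 + h₂ l • X₂ l.1,
      ![-(h₂ l * l.2 2) / 2, -h₁ l * l.2 2 / 2, 0]) := by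
  obtain ⟨D₁, hD₁, e₁⟩ := exists_hasFDerivAt_h₁ l
  obtain ⟨D₂, hD₂, e₂⟩ := exists_hasFDerivAt_h₂ l
  have hD : HasFDerivAt H (h₂ l • D₂ - h₁ l • D₁) l := by
    rw [show H = fun l => (h₂ l ^ 2 - h₁ l ^ 2) * (1 / 2) by funext l; rw [H]; ring]
    refine (((hD₂.pow 2).sub (hD₁.pow 2)).mul_const (1 / 2)).congr_fderiv ?_
    ext v <;> simp <;> ring
  rw [hamVF, hD.fderiv]
  ext i <;> fin_cases i <;> simp [e₁, e₂, X₁, X₂] <;> ring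

/-- The Hamiltonian field of `H` is that of the maximum principle for the maximizing control
`(-h₁, h₂)`. -/
lemma hamVF_H_eq_hamVF_pmpHam (ν : ℝ) (l : CotM) :
    hamVF H l = hamVF (pmpHam ν (-h₁ l, h₂ l)) l := by
  rw [hamVF_H, hamVF_pmpHam]

lemma contDiff_hamVF_H : ContDiff ℝ 1 (hamVF H) := by
  have hb (i : Fin 3) : ContDiff ℝ 1 fun l : CotM => l.1 i := by fun_prop
  have hf (i : Fin 3) : ContDiff ℝ 1 fun l : CotM => l.2 i := by fun_prop
  rw [funext hamVF_H]
  simp only [h₁_eq, h₂_eq]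
  refine ContDiff.prodMk (contDiff_pi.2 fun i => ?_) (contDiff_pi.2 fun i => ?_) <;>
    fin_cases i <;> simp [X₁, X₂] <;> fun_prop

/-! ### The geodesics -/

/-- `∫₀ᵗ e^{cs} ds`, which is `(e^{ct} - 1) / c` for `c ≠ 0` and `t` for `c = 0`. -/
noncomputable def expInt (c t : ℝ) : ℝ := ∫ s in (0 : ℝ)..t, Real.exp (c * s)

/-- The vertical coordinate of the geodesics with vertical momentum `c`. -/
noncomputable def geodZ (c t : ℝ) : ℝ :=
  ∫ s in (0 : ℝ)..t, (expInt (-c) s * Real.exp (c * s) - expInt c s * Real.exp (-c * s)) / 4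

/-- The geodesic from `q₀` whose initial rapidity is `log u` and whose vertical momentum is `c`:
its null coordinates are `x + y = u ∫₀ᵗ e^{cs} ds` and `x - y = u⁻¹ ∫₀ᵗ e^{-cs} ds`. -/
noncomputable def geod (u c t : ℝ) : M :=
  ![(u * expInt c t + u⁻¹ * expInt (-c) t) / 2, (u * expInt c t - u⁻¹ * expInt (-c) t) / 2,
    geodZ c t]

/-- The control `(cosh ψ, sinh ψ)`, with `e^ψ = u e^{ct}`, of the geodesic `geod u c`. -/
noncomputable def geodControl (u c t : ℝ) : ℝ × ℝ :=
  ((u * Real.exp (c * t) + u⁻¹ * Real.exp (-c * t)) / 2,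
    (u * Real.exp (c * t) - u⁻¹ * Real.exp (-c * t)) / 2)

/-- The covector at `q₀` with `h₁ = -cosh ψ`, `h₂ = sinh ψ`, where `e^ψ = u`, and with vertical
momentum `c`. -/
noncomputable def covector (u c : ℝ) : CotM := (q₀, ![-(u + u⁻¹) / 2, (u - u⁻¹) / 2, c])

/-- The lift of `geod u c` to `T*M`, the integral curve of `hamVF H` from `covector u c`. -/
noncomputable def geodLift (u c t : ℝ) : CotM :=
  (geod u c t, ![-(u + u⁻¹) / 2 - c * geod u c t 1 / 2, (u - u⁻¹) / 2 + c * geod u c t 0 / 2, c])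

lemma hasDerivAt_fin_three {q : ℝ → M} {v : M} {t : ℝ} (h0 : HasDerivAt (fun s => q s 0) (v 0) t)
    (h1 : HasDerivAt (fun s => q s 1) (v 1) t) (h2 : HasDerivAt (fun s => q s 2) (v 2) t) :
    HasDerivAt q v t :=
  hasDerivAt_pi.2 fun i => by fin_cases i <;> assumption

lemma hasDerivAt_expInt (c t : ℝ) : HasDerivAt (expInt c) (Real.exp (c * t)) t :=
  intervalIntegral.integral_hasDerivAt_right (Continuous.intervalIntegrable (by fun_prop) _ _)
    (Continuous.stronglyMeasurableAtFilter (by fun_prop) _ _)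
    (Continuous.continuousAt (by fun_prop))

lemma continuous_expInt (c : ℝ) : Continuous (expInt c) :=
  continuous_iff_continuousAt.2 fun t => (hasDerivAt_expInt c t).continuousAt

@[simp] lemma expInt_at_zero (c : ℝ) : expInt c 0 = 0 := by simp [expInt]

@[simp] lemma geodZ_at_zero (c : ℝ) : geodZ c 0 = 0 := by simp [geodZ]

lemma mul_expInt (c t : ℝ) : c * expInt c t = Real.exp (c * t) - 1 := by
  have h : ∀ s ∈ uIcc 0 t, HasDerivAt (fun s => Real.exp (c * s)) (c * Real.exp (c * s)) s := by
    intro s _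
    simpa [mul_comm] using ((hasDerivAt_id s).const_mul c).exp
  have := intervalIntegral.integral_eq_sub_of_hasDerivAt h
    (Continuous.intervalIntegrable (by fun_prop) _ _)
  simpa only [expInt, mul_zero, Real.exp_zero, intervalIntegral.integral_const_mul] using this

lemma hasDerivAt_geodZ (c t : ℝ) : HasDerivAt (geodZ c)
    ((expInt (-c) t * Real.exp (c * t) - expInt c t * Real.exp (-c * t)) / 4) t := by
  have h1 := continuous_expInt c
  have h2 := continuous_expInt (-c)
  exact intervalIntegral.integral_hasDerivAt_right (Continuous.intervalIntegrable (by fun_prop) _ _)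
    (Continuous.stronglyMeasurableAtFilter (by fun_prop) _ _)
    (Continuous.continuousAt (by fun_prop))

lemma geod_at_zero (u c : ℝ) : geod u c 0 = q₀ := by
  ext i; fin_cases i <;> simp [geod, q₀]

lemma geod_x_add_y (u c t : ℝ) : geod u c t 0 + geod u c t 1 = u * expInt c t := by
  simp [geod]; ring

/-- Along a geodesic the slope `e^ψ` of the null coordinate `x + y` is an affine function of
`x + y` itself. -/
lemma geod_slope (u c t : ℝ) :
    u + c * (geod u c t 0 + geod u c t 1) = u * Real.exp (c * t) := by
  rw [geod_x_add_y]; linear_combination u * mul_expInt c t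

lemma h₁_geodLift (u c t : ℝ) : h₁ (geodLift u c t) = -(geodControl u c t).1 := by
  have h1 := mul_expInt c t
  have h2 := mul_expInt (-c) t
  simp [h₁_eq, geodLift, geodControl, geod] at *
  linear_combination (-u / 2) * h1 - (u⁻¹ / 2) * h2

lemma h₂_geodLift (u c t : ℝ) : h₂ (geodLift u c t) = (geodControl u c t).2 := by
  have h1 := mul_expInt c t
  have h2 := mul_expInt (-c) t
  simp [h₂_eq, geodLift, geodControl, geod] at *
  linear_combination (u / 2) * h1 - (u⁻¹ / 2) * h2

lemma geodControl_mem_unitControls {u : ℝ} (hu : 0 < u) (c t : ℝ) :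
    geodControl u c t ∈ unitControls := by
  refine ⟨?_, by simp only [geodControl]; positivity⟩
  have h : Real.exp (c * t) * Real.exp (-c * t) = 1 := by rw [← Real.exp_add]; simp
  have hu' : u * u⁻¹ = 1 := mul_inv_cancel₀ hu.ne'
  simp only [geodControl]
  linear_combination (u * u⁻¹) * h + hu'

lemma hasDerivAt_geod (u : ℝ) (hu : u ≠ 0) (c t : ℝ) : HasDerivAt (geod u c)
    ((geodControl u c t).1 • X₁ (geod u c t) + (geodControl u c t).2 • X₂ (geod u c t)) t := by
  have h1 := (hasDerivAt_expInt c t).const_mul u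
  have h2 := (hasDerivAt_expInt (-c) t).const_mul u⁻¹
  refine hasDerivAt_fin_three ?_ ?_ ?_
  · refine ((h1.add h2).div_const 2).congr_deriv ?_
    simp [geodControl, X₁, X₂]
  · refine ((h1.sub h2).div_const 2).congr_deriv ?_
    simp [geodControl, X₁, X₂]
  · refine (hasDerivAt_geodZ c t).congr_deriv ?_
    simp [geodControl, X₁, X₂, geod]
    field_simp
    ring

lemma hasDerivAt_geodLift (u : ℝ) (hu : u ≠ 0) (c t : ℝ) :
    HasDerivAt (geodLift u c) (hamVF H (geodLift u c t)) t := by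
  rw [hamVF_H, h₁_geodLift, h₂_geodLift, neg_neg]
  have hq := hasDerivAt_geod u hu c t
  refine HasDerivAt.prodMk hq ?_
  have h0 := hasDerivAt_pi.1 hq 0
  have h1 := hasDerivAt_pi.1 hq 1
  refine hasDerivAt_fin_three ?_ ?_ ?_
  · refine (((h1.const_mul c).div_const 2).const_sub (-(u + u⁻¹) / 2)).congr_deriv ?_
    simp [X₁, X₂, geodLift]; ring
  · refine (((h0.const_mul c).div_const 2).const_add ((u - u⁻¹) / 2)).congr_deriv ?_
    simp [X₁, X₂, geodLift]; ring
  · exact hasDerivAt_const t c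

lemma geodLift_at_zero (u c : ℝ) : geodLift u c 0 = covector u c := by
  simp [geodLift, covector, geod_at_zero, q₀]

lemma flow_covector (u : ℝ) (hu : u ≠ 0) (c t : ℝ) :
    flow (hamVF H) t (covector u c) = geodLift u c t := by
  have hex : ∃ γ : ℝ → CotM, γ 0 = covector u c ∧ ∀ s, HasDerivAt γ (hamVF H (γ s)) s :=
    ⟨geodLift u c, geodLift_at_zero u c, hasDerivAt_geodLift u hu c⟩
  rw [flow, dif_pos hex]
  exact congrFun (eq_of_hasDerivAt_of_contDiff contDiff_hamVF_H hex.choose_spec.2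
    (hasDerivAt_geodLift u hu c)
    (hex.choose_spec.1.trans (geodLift_at_zero u c).symm)) t

lemma Exp_covector (u : ℝ) (hu : u ≠ 0) (c t : ℝ) : Exp (covector u c, t) = geod u c t := by
  rw [Exp, flow_covector u hu]; rfl

lemma mem_C_iff {l : CotM} : l ∈ C ↔ ∃ u c : ℝ, 0 < u ∧ l = covector u c := by
  constructor
  · rintro ⟨hq, hH, hneg⟩
    obtain ⟨q, p⟩ := l
    obtain rfl : q = q₀ := hq
    simp only [H, h₁_eq, h₂_eq, q₀, Pi.zero_apply, zero_mul, zero_div, sub_zero, add_zero]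
      at hH hneg
    have hmul : (p 1 - p 0) * (-p 0 - p 1) = 1 := by linarith
    have hpos : 0 < p 1 - p 0 := by
      by_contra! h
      nlinarith
    have hinv : (p 1 - p 0)⁻¹ = -p 0 - p 1 := inv_eq_of_mul_eq_one_right hmul
    refine ⟨p 1 - p 0, p 2, hpos, ?_⟩
    rw [covector, hinv]
    refine Prod.ext rfl ?_
    ext i; fin_cases i <;> simp; ring
  · rintro ⟨u, c, hu, rfl⟩
    have hu' : u * u⁻¹ = 1 := mul_inv_cancel₀ hu.ne'
    have := inv_pos.2 hu
    refine ⟨rfl, ?_, ?_⟩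
    · simp [H, h₁_eq, h₂_eq, covector, q₀]; linear_combination -hu'
    · simp [h₁_eq, covector, q₀]; linarith

/-! ### Horizontal curves in null coordinates -/

lemma hasDerivAt_null_coordinates {q : ℝ → M} {w : ℝ × ℝ} {t : ℝ}
    (h : HasDerivAt q (w.1 • X₁ (q t) + w.2 • X₂ (q t)) t) :
    HasDerivAt (fun s => q s 0 + q s 1) (w.1 + w.2) t ∧
    HasDerivAt (fun s => q s 0 - q s 1) (w.1 - w.2) t ∧
    HasDerivAt (fun s => q s 2)
      (((q t 0 - q t 1) * (w.1 + w.2) - (q t 0 + q t 1) * (w.1 - w.2)) / 4) t := by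
  rw [hasDerivAt_pi] at h
  refine ⟨((h 0).add (h 1)).congr_deriv ?_, ((h 0).sub (h 1)).congr_deriv ?_,
    (h 2).congr_deriv ?_⟩ <;> simp [X₁, X₂]
  ring

lemma hasDerivAt_mul_sub_four_mul {q : ℝ → M} {w : ℝ × ℝ} {t : ℝ}
    (h : HasDerivAt q (w.1 • X₁ (q t) + w.2 • X₂ (q t)) t) :
    HasDerivAt (fun s => (q s 0 + q s 1) * (q s 0 - q s 1) - 4 * q s 2)
      (2 * ((q t 0 + q t 1) * (w.1 - w.2))) t := by
  obtain ⟨ha, hb, hz⟩ := hasDerivAt_null_coordinates h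
  refine ((ha.mul hb).sub (hz.const_mul 4)).congr_deriv ?_
  ring

lemma hasDerivAt_mul_add_four_mul {q : ℝ → M} {w : ℝ × ℝ} {t : ℝ}
    (h : HasDerivAt q (w.1 • X₁ (q t) + w.2 • X₂ (q t)) t) :
    HasDerivAt (fun s => (q s 0 + q s 1) * (q s 0 - q s 1) + 4 * q s 2)
      (2 * ((q t 0 - q t 1) * (w.1 + w.2))) t := by
  obtain ⟨ha, hb, hz⟩ := hasDerivAt_null_coordinates h
  refine ((ha.mul hb).add (hz.const_mul 4)).congr_deriv ?_
  ring

lemma ac_coordinate {q : ℝ → M} {a b : ℝ} (h : AbsolutelyContinuousOnInterval q a b)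
    (i : Fin 3) : AbsolutelyContinuousOnInterval (fun s => q s i) a b :=
  AbsolutelyContinuousOnInterval.lipschitzOnWith_comp (g := fun p : M => p i)
    ((LipschitzWith.eval (α := fun _ : Fin 3 => ℝ) i).lipschitzOnWith (s := univ)) h
    (mapsTo_univ _ _)

lemma solvesControlSystem_mono {V W : Set (ℝ × ℝ)} {T : ℝ} {q : ℝ → M} (hVW : V ⊆ W)
    (h : SolvesControlSystem V T q) : SolvesControlSystem W T q :=
  Filter.Eventually.mono h fun _ ⟨u, hu, hd⟩ => ⟨u, hVW hu, hd⟩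

lemma solvesControlSystem_restrict {V : Set (ℝ × ℝ)} {S T : ℝ} {q : ℝ → M} (hST : S ≤ T)
    (h : SolvesControlSystem V T q) : SolvesControlSystem V S q :=
  ae_restrict_of_ae_restrict_of_subset (Icc_subset_Icc le_rfl hST) h

lemma unitControls_subset : unitControls ⊆ timelikeControls := by
  rintro ⟨a, b⟩ ⟨h, ha⟩
  exact abs_lt_of_sq_lt_sq (by simp only at h; linarith) ha.le

lemma null_pos_of_timelike {w : ℝ × ℝ} (hw : w ∈ timelikeControls) :
    0 < w.1 + w.2 ∧ 0 < w.1 - w.2 := by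
  obtain ⟨h1, h2⟩ := abs_lt.1 (show |w.2| < w.1 from hw)
  constructor <;> linarith

section Timelike

variable {T : ℝ} {q : ℝ → M}

lemma null_pos (hT : 0 < T) (hac : AbsolutelyContinuousOnInterval q 0 T)
    (hode : SolvesControlSystem timelikeControls T q) (h0 : q 0 = q₀) :
    0 < q T 0 + q T 1 ∧ 0 < q T 0 - q T 1 := by
  constructor
  · have := AbsolutelyContinuousOnInterval.lt_of_ae_hasDerivAt_pos
      (f := fun s => q s 0 + q s 1) ((ac_coordinate hac 0).add (ac_coordinate hac 1)) hT (by
        filter_upwards [hode] with t ⟨w, hw, hd⟩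
        exact ⟨_, (null_pos_of_timelike hw).1, (hasDerivAt_null_coordinates hd).1⟩)
    simpa [h0, q₀] using this
  · have := AbsolutelyContinuousOnInterval.lt_of_ae_hasDerivAt_pos
      (f := fun s => q s 0 - q s 1) ((ac_coordinate hac 0).sub (ac_coordinate hac 1)) hT (by
        filter_upwards [hode] with t ⟨w, hw, hd⟩
        exact ⟨_, (null_pos_of_timelike hw).2, (hasDerivAt_null_coordinates hd).2.1⟩)
    simpa [h0, q₀] using this

lemma null_pos_of_mem (hac : AbsolutelyContinuousOnInterval q 0 T)
    (hode : SolvesControlSystem timelikeControls T q) (h0 : q 0 = q₀) {t : ℝ}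
    (ht : t ∈ Ioc 0 T) : 0 < q t 0 + q t 1 ∧ 0 < q t 0 - q t 1 := by
  refine null_pos ht.1 (hac.mono ?_) (solvesControlSystem_restrict ht.2 hode) h0
  rw [uIcc_of_le ht.1.le, uIcc_of_le (ht.1.le.trans ht.2)]
  exact Icc_subset_Icc le_rfl ht.2

lemma abs_vertical_lt (hT : 0 < T) (hac : AbsolutelyContinuousOnInterval q 0 T)
    (hode : SolvesControlSystem timelikeControls T q) (h0 : q 0 = q₀) :
    |4 * q T 2| < (q T 0 + q T 1) * (q T 0 - q T 1) := by
  have hx := (ac_coordinate hac 0).add (ac_coordinate hac 1)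
  have hy := (ac_coordinate hac 0).sub (ac_coordinate hac 1)
  have hz := (ac_coordinate hac 2).const_mul 4
  have hpos : ∀ᵐ t ∂(volume.restrict (Icc 0 T)), t ∈ Ioc 0 T := by
    rw [← Measure.restrict_congr_set (Ioc_ae_eq_Icc (a := 0) (b := T))]
    exact ae_restrict_mem measurableSet_Ioc
  have h1 := AbsolutelyContinuousOnInterval.lt_of_ae_hasDerivAt_pos
    (f := fun s => (q s 0 + q s 1) * (q s 0 - q s 1) - 4 * q s 2) ((hx.mul hy).sub hz) hT (by
      filter_upwards [hode, hpos] with t ⟨w, hw, hd⟩ ht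
      exact ⟨_, mul_pos two_pos (mul_pos (null_pos_of_mem hac hode h0 ht).1
        (null_pos_of_timelike hw).2), hasDerivAt_mul_sub_four_mul hd⟩)
  have h2 := AbsolutelyContinuousOnInterval.lt_of_ae_hasDerivAt_pos
    (f := fun s => (q s 0 + q s 1) * (q s 0 - q s 1) + 4 * q s 2) ((hx.mul hy).add hz) hT (by
      filter_upwards [hode, hpos] with t ⟨w, hw, hd⟩ ht
      exact ⟨_, mul_pos two_pos (mul_pos (null_pos_of_mem hac hode h0 ht).2
        (null_pos_of_timelike hw).1), hasDerivAt_mul_add_four_mul hd⟩)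
  simp only [h0, q₀, Pi.zero_apply] at h1 h2
  rw [abs_lt]
  constructor <;> linarith

lemma null_mem_Icc (hac : AbsolutelyContinuousOnInterval q 0 T)
    (hode : SolvesControlSystem timelikeControls T q) (h0 : q 0 = q₀) {t : ℝ}
    (ht : t ∈ Icc 0 T) : q t 0 + q t 1 ∈ Icc 0 (q T 0 + q T 1) := by
  have hmono : MonotoneOn (fun s => q s 0 + q s 1) (Icc 0 T) :=
    AbsolutelyContinuousOnInterval.monotoneOn_of_ae_hasDerivAt_nonneg
      ((ac_coordinate hac 0).add (ac_coordinate hac 1)) (by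
        filter_upwards [hode] with t ⟨w, hw, hd⟩
        exact ⟨_, (null_pos_of_timelike hw).1.le, (hasDerivAt_null_coordinates hd).1⟩)
  have hT := ht.1.trans ht.2
  refine ⟨?_, hmono ht ⟨hT, le_rfl⟩ ht.2⟩
  simpa [h0, q₀] using hmono ⟨le_rfl, hT⟩ ht ht.1

end Timelike

/-! ### The calibration of a geodesic -/

lemma exists_primitive_inv_affine (u c : ℝ) :
    ∃ G : ℝ → ℝ, ∀ s, 0 < u + c * s → HasDerivAt G (u + c * s)⁻¹ s := by
  rcases eq_or_ne c 0 with rfl | hc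
  · exact ⟨fun s => s * u⁻¹, fun s _ => by simpa using hasDerivAt_mul_const (x := s) u⁻¹⟩
  · refine ⟨fun s => Real.log (u + c * s) / c, fun s hs => ?_⟩
    refine (((((hasDerivAt_id s).const_mul c).const_add u).log hs.ne').div_const c).congr_deriv ?_
    have := hs.ne'
    simp only [id]
    field_simp

/-- The calibration of the geodesic `geod u c`, where `G` is a primitive of `a ↦ (u + c a)⁻¹`, in
the null coordinates `a = x + y`, `b = x - y`. -/
noncomputable def calibration (G : ℝ → ℝ) (u c : ℝ) (q : M) : ℝ :=
  (G (q 0 + q 1) + u * (q 0 - q 1) + c * ((q 0 + q 1) * (q 0 - q 1) - 4 * q 2) / 2) / 2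

lemma hasDerivAt_calibration {G : ℝ → ℝ} {u c : ℝ}
    (hG : ∀ s, 0 < u + c * s → HasDerivAt G (u + c * s)⁻¹ s) {q : ℝ → M} {w : ℝ × ℝ} {t : ℝ}
    (h : HasDerivAt q (w.1 • X₁ (q t) + w.2 • X₂ (q t)) t)
    (hpos : 0 < u + c * (q t 0 + q t 1)) :
    HasDerivAt (fun s => calibration G u c (q s))
      (((w.1 + w.2) / (u + c * (q t 0 + q t 1)) +
        (w.1 - w.2) * (u + c * (q t 0 + q t 1))) / 2) t := by
  obtain ⟨ha, hb, -⟩ := hasDerivAt_null_coordinates h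
  have hG' := (hG _ hpos).comp t ha
  refine ((((hG'.add (hb.const_mul u)).add
    (((hasDerivAt_mul_sub_four_mul h).const_mul c).div_const 2))).div_const 2).congr_deriv ?_
  rw [div_eq_inv_mul (w.1 + w.2)]
  ring

/-- The arithmetic-geometric mean inequality with its error term: `p / k` and `k / p` have
product one, so that their mean exceeds one by a square. -/
lemma calibration_rate_sub_one {w : ℝ × ℝ} (hw : w ∈ unitControls) {k : ℝ} (hk : 0 < k) :
    ((w.1 + w.2) / k + (w.1 - w.2) * k) / 2 - 1 =
      (w.1 + w.2 - k) ^ 2 / (2 * (w.1 + w.2) * k) := by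
  have hp := (null_pos_of_timelike (unitControls_subset hw)).1
  have hr : w.1 - w.2 = 1 / (w.1 + w.2) := by
    rw [eq_div_iff hp.ne']; linear_combination hw.1
  rw [hr]
  field_simp
  ring

lemma ac_calibration {G : ℝ → ℝ} {u c : ℝ}
    (hG : ∀ s, 0 < u + c * s → HasDerivAt G (u + c * s)⁻¹ s) {q : ℝ → M} {T A : ℝ}
    (hT : 0 ≤ T) (hac : AbsolutelyContinuousOnInterval q 0 T) (hu : 0 < u) (hA : 0 < u + c * A)
    (hq : ∀ t ∈ Icc 0 T, q t 0 + q t 1 ∈ Icc 0 A) :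
    AbsolutelyContinuousOnInterval (fun s => calibration G u c (q s)) 0 T := by
  have hmin : 0 < min u (u + c * A) := lt_min hu hA
  have hle : ∀ s ∈ Icc 0 A, min u (u + c * A) ≤ u + c * s := by
    intro s hs
    rcases le_total 0 c with hc | hc
    · exact (min_le_left _ _).trans (by nlinarith [hs.1])
    · exact (min_le_right _ _).trans (by nlinarith [hs.2])
  have hlip : LipschitzOnWith (Real.toNNReal (min u (u + c * A))⁻¹) G (Icc 0 A) := by
    refine (convex_Icc 0 A).lipschitzOnWith_of_nnnorm_hasDerivWithin_le
      (fun s hs => (hG s (hmin.trans_le (hle s hs))).hasDerivWithinAt) fun s hs => ?_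
    rw [← NNReal.coe_le_coe, coe_nnnorm, Real.coe_toNNReal _ (by positivity), norm_inv,
      Real.norm_of_nonneg (hmin.trans_le (hle s hs)).le]
    exact inv_anti₀ hmin (hle s hs)
  have hx := (ac_coordinate hac 0).add (ac_coordinate hac 1)
  have hy := (ac_coordinate hac 0).sub (ac_coordinate hac 1)
  have hz := (ac_coordinate hac 2).const_mul 4
  have hGx : AbsolutelyContinuousOnInterval (fun s => G (q s 0 + q s 1)) 0 T :=
    AbsolutelyContinuousOnInterval.lipschitzOnWith_comp hlip hx (by rwa [uIcc_of_le hT])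
  have h := (((hGx.add (hy.const_mul u)).add
    ((((hx.mul hy).sub hz).const_mul (c / 2)))).const_mul (1 / 2))
  convert h using 1
  funext s
  simp [calibration]
  ring

/-- The calibration grows at least at unit rate along every arclength parametrized timelike curve,
and a curve along which its total growth is the elapsed time has the slope `u + c (x + y)` of the
geodesic. -/
lemma time_le_calibration {G : ℝ → ℝ} {u c : ℝ}
    (hG : ∀ s, 0 < u + c * s → HasDerivAt G (u + c * s)⁻¹ s) (hu : 0 < u) {q : ℝ → M} {q₁ : M}
    {T : ℝ} (h : IsAdmissible q₁ T q) (hA : 0 < u + c * (q₁ 0 + q₁ 1)) :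
    T ≤ calibration G u c q₁ - calibration G u c q₀ ∧
    (calibration G u c q₁ - calibration G u c q₀ ≤ T →
      ∀ᵐ t ∂(volume.restrict (Icc 0 T)), ∃ w ∈ unitControls,
        HasDerivAt q (w.1 • X₁ (q t) + w.2 • X₂ (q t)) t ∧
        w.1 + w.2 = u + c * (q t 0 + q t 1)) := by
  have hT := h.pos
  have hmem : ∀ t ∈ Icc 0 T, q t 0 + q t 1 ∈ Icc 0 (q₁ 0 + q₁ 1) := fun t ht =>
    h.final ▸ null_mem_Icc h.ac (solvesControlSystem_mono unitControls_subset h.ode) h.init ht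
  have hslope : ∀ t ∈ Icc 0 T, 0 < u + c * (q t 0 + q t 1) := by
    intro t ht
    obtain ⟨h1, h2⟩ := hmem t ht
    rcases le_total 0 c with hc | hc <;> nlinarith
  set f : ℝ → ℝ := fun s => calibration G u c (q s) - s with hf
  have hfac : AbsolutelyContinuousOnInterval f 0 T :=
    (ac_calibration hG hT.le h.ac hu hA hmem).sub (contDiff_id.absolutelyContinuousOnInterval 0 T)
  have hfd : ∀ᵐ t ∂(volume.restrict (Icc 0 T)), ∃ w ∈ unitControls,
      HasDerivAt q (w.1 • X₁ (q t) + w.2 • X₂ (q t)) t ∧ 0 < u + c * (q t 0 + q t 1) ∧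
      HasDerivAt f ((w.1 + w.2 - (u + c * (q t 0 + q t 1))) ^ 2 /
        (2 * (w.1 + w.2) * (u + c * (q t 0 + q t 1)))) t := by
    filter_upwards [h.ode, ae_restrict_mem measurableSet_Icc] with t ⟨w, hw, hd⟩ ht
    refine ⟨w, hw, hd, hslope t ht, ?_⟩
    rw [← calibration_rate_sub_one hw (hslope t ht)]
    exact (hasDerivAt_calibration hG hd (hslope t ht)).sub (hasDerivAt_id t)
  have hmono : MonotoneOn f (Icc 0 T) := hfac.monotoneOn_of_ae_hasDerivAt_nonneg (by
    filter_upwards [hfd] with t ⟨w, hw, _, hk, hd⟩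
    have := (null_pos_of_timelike (unitControls_subset hw)).1
    exact ⟨_, by positivity, hd⟩)
  have hle := hmono (left_mem_Icc.2 hT.le) (right_mem_Icc.2 hT.le) hT.le
  simp only [hf, h.init, h.final] at hle
  refine ⟨by linarith, fun hge => ?_⟩
  have hconst := hmono.ae_hasDerivAt_eq_zero (by simp only [hf, h.init, h.final]; linarith)
  filter_upwards [hfd, hconst] with t ⟨w, hw, hq, hk, hd⟩ h0
  refine ⟨w, hw, hq, ?_⟩
  have hp := (null_pos_of_timelike (unitControls_subset hw)).1
  rcases div_eq_zero_iff.1 (h0 _ hd) with h1 | h1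
  · exact sub_eq_zero.1 (pow_eq_zero_iff two_ne_zero |>.1 h1)
  · exact absurd h1 (by positivity)

/-! ### Optimality of the geodesics -/

lemma contDiff_geodLift {u : ℝ} (hu : u ≠ 0) (c : ℝ) : ContDiff ℝ 1 (geodLift u c) :=
  contDiff_one_of_hasDerivAt (hasDerivAt_geodLift u hu c)
    (contDiff_hamVF_H.continuous.comp
      (continuous_iff_continuousAt.2 fun t => (hasDerivAt_geodLift u hu c t).continuousAt))

lemma contDiff_geod {u : ℝ} (hu : u ≠ 0) (c : ℝ) : ContDiff ℝ 1 (geod u c) :=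
  contDiff_fst.comp (contDiff_geodLift hu c)

lemma isAdmissible_geod {u : ℝ} (hu : 0 < u) (c : ℝ) {T : ℝ} (hT : 0 < T) :
    IsAdmissible (geod u c T) T (geod u c) where
  pos := hT
  ac := (contDiff_geod hu.ne' c).contDiffOn.absolutelyContinuousOnInterval
  ode := .of_forall fun t =>
    ⟨geodControl u c t, geodControl_mem_unitControls hu c t, hasDerivAt_geod u hu.ne' c t⟩
  init := geod_at_zero u c
  final := rfl

lemma geod_slope_pos {u : ℝ} (hu : 0 < u) (c t : ℝ) :
    0 < u + c * (geod u c t 0 + geod u c t 1) := by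
  rw [geod_slope]; positivity

lemma geodControl_fst_add_snd (u c t : ℝ) :
    (geodControl u c t).1 + (geodControl u c t).2 = u * Real.exp (c * t) := by
  simp only [geodControl]; ring

lemma calibration_geod {G : ℝ → ℝ} {u c : ℝ}
    (hG : ∀ s, 0 < u + c * s → HasDerivAt G (u + c * s)⁻¹ s) (hu : 0 < u) (T : ℝ) :
    calibration G u c (geod u c T) - calibration G u c q₀ = T := by
  have hd : ∀ t, HasDerivAt (fun s => calibration G u c (geod u c s) - s) 0 t := by
    intro t
    have hk := geod_slope_pos hu c t
    refine ((hasDerivAt_calibration hG (hasDerivAt_geod u hu.ne' c t) hk).sub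
      (hasDerivAt_id t)).congr_deriv ?_
    rw [calibration_rate_sub_one (geodControl_mem_unitControls hu c t) hk,
      geodControl_fst_add_snd, geod_slope, sub_self]
    simp
  have := is_const_of_deriv_eq_zero (fun t => (hd t).differentiableAt) (fun t => (hd t).deriv) T 0
  simp only [geod_at_zero] at this
  linarith

/-- The slope equation `d(x + y)/dt = u + c (x + y)` determines an arclength parametrized timelike
curve: it is linear in `x + y`, it gives the slope of `x - y` as the inverse, and then `z` by
quadrature. -/
lemma eqOn_geod_of_slope {u : ℝ} (hu : 0 < u) (c : ℝ) {q : ℝ → M} {T : ℝ} (hT : 0 ≤ T)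
    (hac : AbsolutelyContinuousOnInterval q 0 T) (h0 : q 0 = q₀)
    (h : ∀ᵐ t ∂(volume.restrict (Icc 0 T)), ∃ w ∈ unitControls,
        HasDerivAt q (w.1 • X₁ (q t) + w.2 • X₂ (q t)) t ∧
        w.1 + w.2 = u + c * (q t 0 + q t 1)) :
    EqOn q (geod u c) (Icc 0 T) := by
  have hgac : AbsolutelyContinuousOnInterval (geod u c) 0 T :=
    (contDiff_geod hu.ne' c).contDiffOn.absolutelyContinuousOnInterval
  have hg := hasDerivAt_geod u hu.ne' c
  have hIcc := ae_restrict_mem (μ := volume) (measurableSet_Icc (a := 0) (b := T))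
  have hg0 := geod_at_zero u c
  have ha : EqOn (fun t => q t 0 + q t 1) (fun t => geod u c t 0 + geod u c t 1) (Icc 0 T) := by
    have hexp : AbsolutelyContinuousOnInterval (fun t => Real.exp (-c * t)) 0 T :=
      ContDiff.absolutelyContinuousOnInterval (by fun_prop) 0 T
    -- `exp (-c t)` is an integrating factor for the linear equation
    have := AbsolutelyContinuousOnInterval.eqOn_of_ae_hasDerivAt
      (f := fun t => ((q t 0 + q t 1) - (geod u c t 0 + geod u c t 1)) * Real.exp (-c * t))
      (g := fun _ => 0)
      ((((ac_coordinate hac 0).add (ac_coordinate hac 1)).sub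
        ((ac_coordinate hgac 0).add (ac_coordinate hgac 1))).mul hexp)
      (contDiff_const.absolutelyContinuousOnInterval 0 T) hT
      (by simp [h0, hg0]) (by
        filter_upwards [h] with t ⟨w, hw, hd, hs⟩
        refine ⟨0, ?_, hasDerivAt_const _ _⟩
        have hE : HasDerivAt (fun s => Real.exp (-c * s)) (Real.exp (-c * t) * -c) t := by
          simpa using ((hasDerivAt_id t).const_mul (-c)).exp
        refine ((((hasDerivAt_null_coordinates hd).1.sub
          (hasDerivAt_null_coordinates (hg t)).1)).mul hE).congr_deriv ?_
        rw [hs, geodControl_fst_add_snd, Pi.sub_apply]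
        linear_combination Real.exp (-c * t) * geod_slope u c t)
    intro t ht
    have h1 := this ht
    simpa [(Real.exp_pos _).ne', sub_eq_zero] using h1
  have hw : ∀ᵐ t ∂(volume.restrict (Icc 0 T)), t ∈ Icc 0 T ∧ ∃ w : ℝ × ℝ,
      HasDerivAt q (w.1 • X₁ (q t) + w.2 • X₂ (q t)) t ∧
      w.1 + w.2 = (geodControl u c t).1 + (geodControl u c t).2 ∧
      w.1 - w.2 = (geodControl u c t).1 - (geodControl u c t).2 := by
    filter_upwards [h, hIcc] with t ⟨w, hw, hd, hs⟩ ht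
    have h1 : w.1 + w.2 = (geodControl u c t).1 + (geodControl u c t).2 := by
      rw [hs, geodControl_fst_add_snd, ← geod_slope]
      exact congrArg (fun r => u + c * r) (ha ht)
    refine ⟨ht, w, hd, h1, ?_⟩
    have hp := (null_pos_of_timelike (unitControls_subset hw)).1
    refine mul_left_cancel₀ hp.ne' ?_
    have := (geodControl_mem_unitControls hu c t).1
    calc (w.1 + w.2) * (w.1 - w.2) = 1 := by linear_combination hw.1
      _ = (w.1 + w.2) * ((geodControl u c t).1 - (geodControl u c t).2) := by
        rw [h1]; linear_combination -this
  have hb : EqOn (fun t => q t 0 - q t 1) (fun t => geod u c t 0 - geod u c t 1) (Icc 0 T) := by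
    refine AbsolutelyContinuousOnInterval.eqOn_of_ae_hasDerivAt
      ((ac_coordinate hac 0).sub (ac_coordinate hac 1))
      ((ac_coordinate hgac 0).sub (ac_coordinate hgac 1)) hT (by simp [h0, hg0]) ?_
    filter_upwards [hw] with t ⟨ht, w, hd, h1, h2⟩
    exact ⟨_, (hasDerivAt_null_coordinates hd).2.1,
      h2 ▸ (hasDerivAt_null_coordinates (hg t)).2.1⟩
  have hz : EqOn (fun t => q t 2) (fun t => geod u c t 2) (Icc 0 T) := by
    refine AbsolutelyContinuousOnInterval.eqOn_of_ae_hasDerivAt (ac_coordinate hac 2)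
      (ac_coordinate hgac 2) hT (by simp [h0, hg0]) ?_
    filter_upwards [hw] with t ⟨ht, w, hd, h1, h2⟩
    refine ⟨_, (hasDerivAt_null_coordinates hd).2.2,
      (hasDerivAt_null_coordinates (hg t)).2.2.congr_deriv ?_⟩
    have h3 : q t 0 + q t 1 = _ := ha ht
    have h4 : q t 0 - q t 1 = _ := hb ht
    rw [h1, h2, h3, h4]
  intro t ht
  have h1 : q t 0 + q t 1 = _ := ha ht
  have h2 : q t 0 - q t 1 = _ := hb ht
  have h3 : q t 2 = _ := hz ht
  ext i
  fin_cases i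
  · change q t 0 = geod u c t 0; linarith
  · change q t 1 = geod u c t 1; linarith
  · exact h3

lemma admissible_time_le {u : ℝ} (hu : 0 < u) (c : ℝ) {t₁ T : ℝ} {q : ℝ → M}
    (h : IsAdmissible (geod u c t₁) T q) : T ≤ t₁ := by
  obtain ⟨G, hG⟩ := exists_primitive_inv_affine u c
  have := (time_le_calibration hG hu h (geod_slope_pos hu c t₁)).1
  rwa [calibration_geod hG hu] at this

lemma eqOn_geod_of_isAdmissible {u : ℝ} (hu : 0 < u) (c : ℝ) {t₁ : ℝ} {q : ℝ → M}
    (h : IsAdmissible (geod u c t₁) t₁ q) : EqOn q (geod u c) (Icc 0 t₁) := by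
  obtain ⟨G, hG⟩ := exists_primitive_inv_affine u c
  exact eqOn_geod_of_slope hu c h.pos.le h.ac h.init
    ((time_le_calibration hG hu h (geod_slope_pos hu c t₁)).2 (calibration_geod hG hu t₁).le)

theorem isUniqueOptimal_geod {u : ℝ} (hu : 0 < u) (c : ℝ) {t₁ : ℝ} (ht₁ : 0 < t₁) :
    IsUniqueOptimal (geod u c t₁) t₁ (geod u c) := by
  have hadm := isAdmissible_geod hu c ht₁
  refine ⟨⟨hadm, fun T' q' h => admissible_time_le hu c h⟩, fun T' q' h => ?_⟩
  obtain rfl : T' = t₁ := le_antisymm (admissible_time_le hu c h.1) (h.2 _ _ hadm)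
  exact ⟨rfl, eqOn_geod_of_isAdmissible hu c h.1⟩

/-! ### The exponential map is a bijection onto the chronological future -/

lemma expInt_pos (c : ℝ) {t : ℝ} (ht : 0 < t) : 0 < expInt c t :=
  intervalIntegral.intervalIntegral_pos_of_pos (Continuous.intervalIntegrable (by fun_prop) _ _)
    (fun _ => Real.exp_pos _) ht

lemma sq_mul_expInt_mul_expInt (c t : ℝ) :
    c ^ 2 * (expInt c t * expInt (-c) t) = 2 * (Real.cosh (c * t) - 1) := by
  have h1 := mul_expInt c t
  have h2 := mul_expInt (-c) t
  have h3 : Real.exp (c * t) * Real.exp (-c * t) = 1 := by rw [← Real.exp_add]; simp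
  rw [Real.cosh_eq, ← neg_mul]
  linear_combination (-(c * -expInt (-c) t)) * h1 - (Real.exp (c * t) - 1) * h2 - h3

lemma sq_mul_geodZ (c t : ℝ) : 2 * c ^ 2 * geodZ c t = Real.sinh (c * t) - c * t := by
  have hd : ∀ s, HasDerivAt
      (fun s => 2 * c ^ 2 * geodZ c s - (Real.sinh (c * s) - c * s)) 0 s := by
    intro s
    have hc : HasDerivAt (fun s => c * s) c s := by
      simpa using (hasDerivAt_id s).const_mul c
    refine (((hasDerivAt_geodZ c s).const_mul (2 * c ^ 2)).sub (hc.sinh.sub hc)).congr_deriv ?_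
    have h1 := mul_expInt c s
    have h2 := mul_expInt (-c) s
    have h3 : Real.exp (c * s) * Real.exp (-c * s) = 1 := by rw [← Real.exp_add]; simp
    rw [Real.cosh_eq, ← neg_mul]
    linear_combination (-(c * Real.exp (c * s) / 2)) * h2 - (c * Real.exp (-c * s) / 2) * h1
      - c * h3
  have := is_const_of_deriv_eq_zero (fun t => (hd t).differentiableAt) (fun t => (hd t).deriv) t 0
  simp only [geodZ_at_zero, mul_zero, Real.sinh_zero, sub_self] at this
  linarith

/-- The function `(sinh p - p) / (cosh p - 1)` takes every value of `(0, 1)` for `p > 0`: its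
limits at `0` and at infinity are `0` and `1`. -/
lemma exists_sinh_sub_eq {r : ℝ} (hr : 0 < r) (hr1 : r < 1) :
    ∃ p, 0 < p ∧ Real.sinh p - p = r * (Real.cosh p - 1) := by
  set f : ℝ → ℝ := fun p => Real.sinh p - p - r * (Real.cosh p - 1) with hf
  have hfc : Continuous f := by
    have := Real.continuous_sinh
    have := Real.continuous_cosh
    fun_prop
  -- `sinh p ≤ p cosh p`, so that `f` is nonpositive for `0 < p ≤ r`
  have hlow : f r ≤ 0 := by
    have h : Real.sinh r ≤ r * Real.cosh r := by
      have hmono : MonotoneOn (fun p => p * Real.cosh p - Real.sinh p) (Ici 0) := by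
        have hd : ∀ p, HasDerivAt (fun p => p * Real.cosh p - Real.sinh p)
            (p * Real.sinh p) p := by
          intro p
          refine (((hasDerivAt_id p).mul (Real.hasDerivAt_cosh p)).sub
            (Real.hasDerivAt_sinh p)).congr_deriv ?_
          simp
        refine monotoneOn_of_deriv_nonneg (convex_Ici 0)
          (fun p _ => (hd p).continuousAt.continuousWithinAt)
          (fun p _ => (hd p).differentiableAt.differentiableWithinAt) fun p hp => ?_
        rw [interior_Ici, mem_Ioi] at hp
        rw [(hd p).deriv]
        exact mul_nonneg hp.le (Real.sinh_pos_iff.2 hp).le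
      have := hmono (mem_Ici.2 le_rfl) (mem_Ici.2 hr.le) hr.le
      simp only [zero_mul, Real.sinh_zero, sub_zero] at this
      linarith
    simp only [hf]
    linarith
  -- `e ^ p` dominates the affine terms once `(1 - r) p ≥ 8`
  have hR : r ≤ 8 / (1 - r) := by
    rw [le_div_iff₀ (by linarith)]; nlinarith
  have hhigh : 0 ≤ f (8 / (1 - r)) := by
    set p := 8 / (1 - r) with hp
    have hp8 : (1 - r) * p = 8 := mul_div_cancel₀ _ (by linarith)
    have hp1 : 8 ≤ p := by nlinarith
    have h1 := Real.quadratic_le_exp_of_nonneg (x := p) (by linarith)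
    have h2 : Real.exp (-p) ≤ 1 := Real.exp_le_one_iff.2 (by linarith)
    have h3 : (1 - r) * (1 + p + p ^ 2 / 2) ≤ (1 - r) * Real.exp p :=
      mul_le_mul_of_nonneg_left h1 (by linarith)
    have h4 : (1 + r) * Real.exp (-p) ≤ 2 := by nlinarith [Real.exp_pos (-p)]
    have h5 : (1 - r) * p ^ 2 = 8 * p := by rw [pow_two, ← mul_assoc, hp8]
    simp only [hf, Real.sinh_eq, Real.cosh_eq]
    nlinarith
  obtain ⟨p, hp, hp0⟩ := intermediate_value_Icc hR hfc.continuousOn ⟨hlow, hhigh⟩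
  exact ⟨p, hr.trans_le hp.1, by simp only [hf] at hp0; linarith⟩

lemma exists_sinh_sub_eq_of_abs_lt_one {r : ℝ} (hr0 : r ≠ 0) (hr : |r| < 1) :
    ∃ p, p ≠ 0 ∧ Real.sinh p - p = r * (Real.cosh p - 1) := by
  rcases hr0.lt_or_gt with h | h
  · rw [abs_of_neg h] at hr
    obtain ⟨p, hp, he⟩ := exists_sinh_sub_eq (neg_pos.2 h) hr
    refine ⟨-p, neg_ne_zero.2 hp.ne', ?_⟩
    rw [Real.sinh_neg, Real.cosh_neg]
    linarith
  · rw [abs_of_pos h] at hr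
    obtain ⟨p, hp, he⟩ := exists_sinh_sub_eq h hr
    exact ⟨p, hp.ne', he⟩

/-- The product `a b` of the null coordinates and the height `z` do not depend on the initial
rapidity of a geodesic; `c` and `t` can be chosen to fit any pair of values with `4 |z| < a b`. -/
lemma exists_geod_invariants {P z : ℝ} (h : |4 * z| < P) :
    ∃ c t : ℝ, 0 < t ∧ expInt c t * expInt (-c) t = P ∧ geodZ c t = z := by
  have hP : 0 < P := (abs_nonneg _).trans_lt h
  rcases eq_or_ne z 0 with rfl | hz
  · refine ⟨0, √P, Real.sqrt_pos.2 hP, ?_, ?_⟩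
    · simp [expInt, Real.mul_self_sqrt hP.le]
    · simp [geodZ]
  · obtain ⟨p, hp, he⟩ := exists_sinh_sub_eq_of_abs_lt_one (r := 4 * z / P)
      (div_ne_zero (mul_ne_zero four_ne_zero hz) hP.ne')
      (by rwa [abs_div, abs_of_pos hP, div_lt_one hP])
    have hcosh : 0 < Real.cosh p - 1 := sub_pos.2 (Real.one_lt_cosh.2 hp)
    -- with `c = p / t` the product is `2 (cosh p - 1) t² / p²`, which determines `t`
    set t := √(P * p ^ 2 / (2 * (Real.cosh p - 1))) with ht
    have ht2 : t ^ 2 = P * p ^ 2 / (2 * (Real.cosh p - 1)) := Real.sq_sqrt (by positivity)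
    have ht0 : 0 < t := Real.sqrt_pos.2 (by positivity)
    have hct : p / t * t = p := div_mul_cancel₀ _ ht0.ne'
    have hc2 : (p / t) ^ 2 = 2 * (Real.cosh p - 1) / P := by
      rw [div_pow, ht2]; field_simp
    have hc0 : (p / t) ^ 2 ≠ 0 := pow_ne_zero 2 (div_ne_zero hp ht0.ne')
    refine ⟨p / t, t, ht0, mul_left_cancel₀ hc0 ?_,
      mul_left_cancel₀ (mul_ne_zero two_ne_zero hc0) ?_⟩
    · rw [sq_mul_expInt_mul_expInt, hct, hc2]; field_simp
    · rw [sq_mul_geodZ, hct, he, hc2]; field_simp; ring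

lemma exists_geod_eq {q : M} (hx : 0 < q 0 + q 1)
    (h : |4 * q 2| < (q 0 + q 1) * (q 0 - q 1)) :
    ∃ u c t : ℝ, 0 < u ∧ 0 < t ∧ geod u c t = q := by
  obtain ⟨c, t, ht, hE, hZ⟩ := exists_geod_invariants h
  have hc := expInt_pos c ht
  have h1 : (q 0 + q 1) / expInt c t * expInt c t = q 0 + q 1 := div_mul_cancel₀ _ hc.ne'
  have h2 : ((q 0 + q 1) / expInt c t)⁻¹ * expInt (-c) t = q 0 - q 1 := by
    rw [inv_div, div_mul_eq_mul_div, hE, mul_div_cancel_left₀ _ hx.ne']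
  refine ⟨(q 0 + q 1) / expInt c t, c, t, div_pos hx hc, ht, ?_⟩
  ext i
  fin_cases i
  · change (_ + _) / 2 = q 0
    rw [h1, h2]; ring
  · change (_ - _) / 2 = q 1
    rw [h1, h2]; ring
  · exact hZ

lemma geod_mem_chronologicalFuture {u : ℝ} (hu : 0 < u) (c : ℝ) {t : ℝ} (ht : 0 < t) :
    geod u c t ∈ chronologicalFuture q₀ :=
  have h := isAdmissible_geod hu c ht
  ⟨t, geod u c, ht, (contDiff_geod hu.ne' c).exists_lipschitzOnWith_Icc 0 t,
    solvesControlSystem_mono unitControls_subset h.ode, h.init, rfl⟩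

lemma exists_geod_eq_of_mem_chronologicalFuture {q₁ : M} (h : q₁ ∈ chronologicalFuture q₀) :
    ∃ u c t : ℝ, 0 < u ∧ 0 < t ∧ geod u c t = q₁ := by
  obtain ⟨T, q, hT, ⟨K, hK⟩, hode, h0, rfl⟩ := h
  have hac : AbsolutelyContinuousOnInterval q 0 T :=
    (by rwa [uIcc_of_le hT.le] : LipschitzOnWith K q (uIcc 0 T)).absolutelyContinuousOnInterval
  exact exists_geod_eq (null_pos hT hac hode h0).1 (abs_vertical_lt hT hac hode h0)

/-- Two geodesics with the same end point are both optimal, hence equal with equal times; the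
slope `u e^{cs}` of `x + y` at two times then recovers `u` and `c`. -/
lemma geod_injective {u u' c c' t t' : ℝ} (hu : 0 < u) (hu' : 0 < u') (ht : 0 < t) (ht' : 0 < t')
    (h : geod u c t = geod u' c' t') : u = u' ∧ c = c' ∧ t = t' := by
  have hadm := isAdmissible_geod hu c ht
  have hadm' := isAdmissible_geod hu' c' ht'
  obtain rfl : t = t' := le_antisymm (admissible_time_le hu' c' (h ▸ hadm))
    (admissible_time_le hu c (h ▸ hadm'))
  have heq : EqOn (geod u c) (geod u' c') (Icc 0 t) :=
    eqOn_geod_of_isAdmissible hu' c' (h ▸ hadm)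
  have hslope : ∀ s ∈ Ioo 0 t, u * Real.exp (c * s) = u' * Real.exp (c' * s) := by
    intro s hs
    refine HasDerivAt.unique ((hasDerivAt_expInt c s).const_mul u)
      (((hasDerivAt_expInt c' s).const_mul u').congr_of_eventuallyEq ?_)
    filter_upwards [Ioo_mem_nhds hs.1 hs.2] with r hr
    rw [← geod_x_add_y, ← geod_x_add_y, heq (Ioo_subset_Icc_self hr)]
  have h1 := hslope (t / 3) ⟨by linarith, by linarith⟩
  have h2 := hslope (t / 3 + t / 3) ⟨by linarith, by linarith⟩
  simp only [mul_add, Real.exp_add] at h2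
  have h3 : Real.exp (c * (t / 3)) = Real.exp (c' * (t / 3)) := by
    refine mul_left_cancel₀ (mul_pos hu (Real.exp_pos (c * (t / 3)))).ne' ?_
    rw [mul_assoc, h2, h1]
    ring
  have hc : c = c' := mul_right_cancel₀ (by positivity) (Real.exp_injective h3)
  rw [h3] at h1
  exact ⟨mul_right_cancel₀ (Real.exp_pos _).ne' h1, hc, rfl⟩

theorem bijOn_Exp : BijOn Exp N (chronologicalFuture q₀) := by
  refine ⟨?_, ?_, ?_⟩
  · rintro ⟨l, t⟩ ⟨hl, ht⟩
    obtain ⟨u, c, hu, rfl⟩ := mem_C_iff.1 hl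
    rw [Exp_covector u hu.ne']
    exact geod_mem_chronologicalFuture hu c ht
  · rintro ⟨l, t⟩ ⟨hl, ht⟩ ⟨l', t'⟩ ⟨hl', ht'⟩ h
    obtain ⟨u, c, hu, rfl⟩ := mem_C_iff.1 hl
    obtain ⟨u', c', hu', rfl⟩ := mem_C_iff.1 hl'
    rw [Exp_covector u hu.ne', Exp_covector u' hu'.ne'] at h
    obtain ⟨rfl, rfl, rfl⟩ := geod_injective hu hu' ht ht' h
    rfl
  · intro q₁ hq₁
    obtain ⟨u, c, t, hu, ht, rfl⟩ := exists_geod_eq_of_mem_chronologicalFuture hq₁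
    exact ⟨(covector u c, t), ⟨mem_C_iff.2 ⟨u, c, hu, rfl⟩, ht⟩, Exp_covector u hu.ne' c t⟩

/-! ### Strict normality -/

/-- The reversed Cauchy-Schwarz inequality. -/
lemma sqrt_le_of_mem_unitControls {v w : ℝ × ℝ} (hw : w ∈ unitControls) (hv : v ∈ U) :
    √(v.1 ^ 2 - v.2 ^ 2) ≤ v.1 * w.1 - v.2 * w.2 := by
  obtain ⟨h1, h2⟩ := null_pos_of_timelike (unitControls_subset hw)
  obtain ⟨h3, h4⟩ := abs_le.1 (show |v.2| ≤ v.1 from hv)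
  rw [Real.sqrt_le_iff]
  constructor
  · nlinarith [mul_nonneg (by linarith : 0 ≤ v.1 - v.2) h1.le,
      mul_nonneg (by linarith : 0 ≤ v.1 + v.2) h2.le]
  · nlinarith [sq_nonneg (v.1 * w.2 - v.2 * w.1), hw.1]

lemma pmpHam_geodLift (v : ℝ × ℝ) (u c t : ℝ) :
    pmpHam (-1) v (geodLift u c t) = √(v.1 ^ 2 - v.2 ^ 2) -
      (v.1 * (geodControl u c t).1 - v.2 * (geodControl u c t).2) := by
  rw [pmpHam, h₁_geodLift, h₂_geodLift]; ring

lemma isExtremalTrajectory_geod {u : ℝ} (hu : 0 < u) (c T : ℝ) :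
    IsExtremalTrajectory (-1) T (geod u c) := by
  refine ⟨geodLift u c, geodControl u c,
    (contDiff_geodLift hu.ne' c).exists_lipschitzOnWith_Icc 0 T, fun _ _ => rfl, .of_forall fun t => ?_⟩
  have hw := geodControl_mem_unitControls hu c t
  have h0 : pmpHam (-1) (geodControl u c t) (geodLift u c t) = 0 := by
    rw [pmpHam_geodLift, hw.1, Real.sqrt_one]
    linear_combination -hw.1
  have hlt : |(geodControl u c t).2| < (geodControl u c t).1 := unitControls_subset hw
  refine ⟨show |(geodControl u c t).2| ≤ (geodControl u c t).1 from hlt.le, ?_,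
    fun v hv => ?_, h0, by simp⟩
  · have h := hasDerivAt_geodLift u hu.ne' c t
    rwa [hamVF_H_eq_hamVF_pmpHam (-1), h₁_geodLift, h₂_geodLift, neg_neg] at h
  · rw [h0, pmpHam_geodLift, sub_nonpos]
    exact sqrt_le_of_mem_unitControls hw hv

/-- A linear function on the cone `U` whose maximum `0` is attained at an interior point of `U`
vanishes. -/
lemma h_eq_zero_of_pmpHam_max {w : ℝ × ℝ} {l : CotM} (hw : w ∈ timelikeControls)
    (hmax : ∀ v ∈ U, pmpHam 0 v l ≤ pmpHam 0 w l) (h0 : pmpHam 0 w l = 0) :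
    h₁ l = 0 ∧ h₂ l = 0 := by
  obtain ⟨hp, hr⟩ := null_pos_of_timelike hw
  rw [h0] at hmax
  have h1 := hmax (1, 1) (by simp [U])
  have h2 := hmax (1, -1) (by simp [U])
  simp only [pmpHam, zero_mul, sub_zero, one_mul, neg_mul] at h0 h1 h2
  -- the value at `w` is a positive combination of the values on the two null directions
  have hsum : (w.1 + w.2) * (h₁ l + h₂ l) + (w.1 - w.2) * (h₁ l + -h₂ l) = 0 := by
    linear_combination 2 * h0
  have h3 := mul_nonpos_of_nonneg_of_nonpos hp.le h1
  have h4 := mul_nonpos_of_nonneg_of_nonpos hr.le h2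
  have h5 := (mul_eq_zero.1 (by linarith : (w.1 + w.2) * (h₁ l + h₂ l) = 0)).resolve_left hp.ne'
  have h6 := (mul_eq_zero.1 (by linarith : (w.1 - w.2) * (h₁ l + -h₂ l) = 0)).resolve_left hr.ne'
  constructor <;> linarith

/-- Along an abnormal extremal the two Hamiltonians `h₁`, `h₂` would vanish identically, and the
derivative of `h₂` is the vertical momentum times `u₁ > 0`, so that the whole covector would
vanish. -/
lemma not_isExtremalTrajectory_geod {u : ℝ} (hu : 0 < u) (c : ℝ) {T : ℝ} (hT : 0 < T) :
    ¬ IsExtremalTrajectory 0 T (geod u c) := by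
  rintro ⟨l, w, ⟨K, hK⟩, hl, hae⟩
  have hIoo : ∀ᵐ t ∂(volume.restrict (Icc 0 T)), t ∈ Ioo 0 T := by
    rw [← Measure.restrict_congr_set (Ioo_ae_eq_Icc (a := 0) (b := T))]
    exact ae_restrict_mem measurableSet_Ioo
  have hmain : ∀ᵐ t ∂(volume.restrict (Icc 0 T)), t ∈ Ioo 0 T ∧ 0 < (w t).1 ∧
      HasDerivAt l (hamVF (pmpHam 0 (w t)) (l t)) t ∧ h₁ (l t) = 0 ∧ h₂ (l t) = 0 ∧
      (l t).2 ≠ 0 := by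
    filter_upwards [hae, hIoo] with t ⟨_, hd, hmax, h0, hne⟩ ht
    -- the control is determined by the trajectory
    have hq : HasDerivAt (geod u c) ((w t).1 • X₁ (l t).1 + (w t).2 • X₂ (l t).1) t := by
      rw [hamVF_pmpHam] at hd
      refine HasDerivAt.congr_of_eventuallyEq
        ((ContinuousLinearMap.fst ℝ M M).hasFDerivAt.comp_hasDerivAt t hd) ?_
      filter_upwards [Ioo_mem_nhds ht.1 ht.2] with s hs
      exact (hl s (Ioo_subset_Icc_self hs)).symm
    have huniq := hq.unique (hasDerivAt_geod u hu.ne' c t)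
    have e1 := congrFun huniq 0
    have e2 := congrFun huniq 1
    simp only [X₁, X₂, Pi.add_apply, Pi.smul_apply, smul_eq_mul, Matrix.cons_val_zero,
      Matrix.cons_val_one, mul_one, mul_zero, add_zero, zero_add] at e1 e2
    have hw : w t ∈ unitControls := by
      rw [show w t = geodControl u c t from Prod.ext e1 e2]
      exact geodControl_mem_unitControls hu c t
    obtain ⟨h1, h2⟩ := h_eq_zero_of_pmpHam_max (unitControls_subset hw) hmax h0
    exact ⟨ht, hw.2, hd, h1, h2, fun h => hne (by rw [h])⟩
  have hcont : ContinuousOn (fun t => h₂ (l t)) (Icc 0 T) := by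
    have hc : Continuous h₂ := by rw [funext h₂_eq]; fun_prop
    exact hc.comp_continuousOn hK.continuousOn
  have hzero : EqOn (fun t => h₂ (l t)) (fun _ => 0) (Icc 0 T) :=
    Measure.eqOn_Icc_of_ae_eq volume hT.ne (hmain.mono fun t ht => ht.2.2.2.2.1) hcont
      continuousOn_const
  have := ae_restrict_Icc_neBot hT
  obtain ⟨t, ht, hw, hd, h1, h2, hne⟩ := hmain.exists
  obtain ⟨D, hD, hDv⟩ := exists_hasFDerivAt_h₂ (l t)
  have hd2 := (hD.comp_hasDerivAt t hd).unique
    ((hasDerivAt_const t (0 : ℝ)).congr_of_eventuallyEq (by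
      filter_upwards [Ioo_mem_nhds ht.1 ht.2] with s hs
      exact hzero (Ioo_subset_Icc_self hs)))
  have hp2 : (l t).2 2 = 0 := by
    rw [hamVF_pmpHam, hDv] at hd2
    simp [X₁, X₂] at hd2
    exact hd2.resolve_left hw.ne'
  refine hne ?_
  rw [h₁_eq, hp2] at h1
  rw [h₂_eq, hp2] at h2
  simp only [mul_zero, zero_div, sub_zero, add_zero] at h1 h2
  ext i
  fin_cases i <;> assumption

end HeisSL

theorem mainTheorem2 :
    -- `Exp : N → I⁺(q₀)` is a bijection, so that `Exp⁻¹` makes sense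
    Set.BijOn HeisSL.Exp HeisSL.N (HeisSL.chronologicalFuture HeisSL.q₀) ∧
    ∀ q₁ ∈ HeisSL.chronologicalFuture HeisSL.q₀,
      ∀ (l : HeisSL.CotM) (t₁ : ℝ), (l, t₁) ∈ HeisSL.N → HeisSL.Exp (l, t₁) = q₁ →
        HeisSL.IsStrictlyNormal t₁ (fun t => HeisSL.Exp (l, t)) ∧
        (∃ K : NNReal, LipschitzOnWith K (fun t => HeisSL.Exp (l, t)) (Set.Icc 0 t₁)) ∧
        HeisSL.IsUniqueOptimal q₁ t₁ (fun t => HeisSL.Exp (l, t)) := by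
  refine ⟨HeisSL.bijOn_Exp, ?_⟩
  rintro _ - l t₁ ⟨hl, ht₁⟩ rfl
  obtain ⟨u, c, hu, rfl⟩ := HeisSL.mem_C_iff.1 hl
  simp only [HeisSL.Exp_covector u hu.ne']
  exact ⟨⟨HeisSL.isExtremalTrajectory_geod hu c t₁, HeisSL.not_isExtremalTrajectory_geod hu c ht₁⟩,
    (HeisSL.contDiff_geod hu.ne' c).exists_lipschitzOnWith_Icc 0 t₁,
    HeisSL.isUniqueOptimal_geod hu c ht₁⟩
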